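/- For integers $m,n$ let $\tau_{m,n}$ be the translation $(x,y)\mapsto(x+m,y+n)$ of the Euclidean plane and let $\sigma$ be the glide reflection $(x,y)\mapsto(x+\tfrac12,-y)$. Let $G$ be the (discrete) wallpaper group generated by $\sigma$ and all $\tau_{m,n}$; thus $G=\{\tau_{m,n},\ \sigma\tau_{m,n} : (m,n)\in\mathbb Z^2\}$ with $\sigma\tau_{m,-n}=\tau_{m,n}\sigma$ and $\sigma^2=\tau_{1,0}$. Let $C^*(G)$ be its full group $C^*$-algebra, i.e. the completion of $\mathbb C[G]$ in the norm $\|f\|=\sup_\pi\|\pi(f)\|$, where $\pi$ runs over all unitary representations of $G$ on Hilbert spaces, and let $\mathcal Z$ be the center of $C^*(G)$. A $C^*$-algebra $A$ with center $\mathcal Z(A)$ is called weakly central if the map $M\mapsto M\cap\mathcal Z(A)$ is injective on the set of maximal modular (two-sided) ideals of $A$ and no maximal modular ideal of $A$ contains $\mathcal Z(A)$. Then $C^*(G)$ is not weakly central. More precisely, for every $\alpha\in\mathbb C$ with $|\alpha|=1$ there are two one-dimensional representations (unital $*$-homomorphisms) $\pi_1,\pi_2\colon C^*(G)\to\mathbb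 C$ with $\pi_1(\sigma)=\alpha$ and $\pi_2(\sigma)=-\alpha$ whose kernels are distinct maximal modular ideals of $C^*(G)$, such that $$\ker\pi_1\cap\mathcal Z=\ker\pi_2\cap\mathcal Z ,$$ and this intersection is a maximal ideal of $\mathcal Z$. -/

import Mathlib

noncomputable section

universe u

/-! ### The full group C⋆-algebra of a discrete group -/

/-- The complex group algebra `ℂ[G]`; a type synonym that carries the involution and the
maximal C⋆-seminorm. -/
def GroupAlg (G : Type u) [Group G] : Type u := MonoidAlgebra ℂ G

namespace GroupAlg

variable {G : Type u} [Group G]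

instance : Ring (GroupAlg G) := inferInstanceAs (Ring (MonoidAlgebra ℂ G))

instance : Algebra ℂ (GroupAlg G) := inferInstanceAs (Algebra ℂ (MonoidAlgebra ℂ G))

/-- The inclusion of the group into its group algebra. -/
def of : G →* GroupAlg G := MonoidAlgebra.of ℂ G

theorem induction_smul_of {p : GroupAlg G → Prop} (f : GroupAlg G) (zero : p 0)
    (smul_of : ∀ (c : ℂ) (g : G), p (c • of g))
    (add : ∀ f₁ f₂, p f₁ → p f₂ → p (f₁ + f₂)) : p f := by
  refine MonoidAlgebra.induction_linear (motive := p) f zero add ?_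
  intro g c
  have : (MonoidAlgebra.single g c : MonoidAlgebra ℂ G) = c • MonoidAlgebra.of ℂ G g := by simp
  rw [this]
  exact smul_of c g

/-- The involution `(∑ c_g g)⋆ = ∑ conj(c_g) g⁻¹`. -/
instance : Star (GroupAlg G) where
  star f := (MonoidAlgebra.coeff f).sum fun g c => star c • of g⁻¹

theorem star_smul_of (c : ℂ) (g : G) : star (c • of g : GroupAlg G) = star c • of g⁻¹ := by
  have h : MonoidAlgebra.coeff (c • of g : GroupAlg G) = Finsupp.single g c := by
    change MonoidAlgebra.coeff (c • MonoidAlgebra.of ℂ G g) = _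
    simp
  change (MonoidAlgebra.coeff (c • of g : GroupAlg G)).sum _ = _
  rw [h]
  exact Finsupp.sum_single_index (by simp)

theorem star_add_aux (f₁ f₂ : GroupAlg G) : star (f₁ + f₂) = star f₁ + star f₂ := by
  classical
  have h : MonoidAlgebra.coeff (f₁ + f₂) = MonoidAlgebra.coeff f₁ + MonoidAlgebra.coeff f₂ := rfl
  change (MonoidAlgebra.coeff (f₁ + f₂)).sum _ = _
  rw [h]
  exact Finsupp.sum_add_index' (by simp) (by simp [add_smul])

theorem star_zero_aux : star (0 : GroupAlg G) = 0 := Finsupp.sum_zero_index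

instance : StarRing (GroupAlg G) where
  star_add := star_add_aux
  star_involutive f := by
    induction f using induction_smul_of with
    | zero => simp only [star_zero_aux]
    | smul_of c g => simp only [star_smul_of, star_star, inv_inv]
    | add f₁ f₂ h₁ h₂ => simp only [star_add_aux, h₁, h₂]
  star_mul f₁ f₂ := by
    induction f₁ using induction_smul_of with
    | zero => simp only [star_zero_aux, zero_mul, mul_zero]
    | add a b ha hb => simp only [star_add_aux, add_mul, mul_add, ha, hb]
    | smul_of c g =>
      induction f₂ using induction_smul_of with
      | zero => simp only [star_zero_aux, zero_mul, mul_zero]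
      | add a b ha hb => simp only [star_add_aux, add_mul, mul_add, ha, hb]
      | smul_of d h =>
        rw [smul_mul_smul_comm, ← map_mul, star_smul_of, star_smul_of, star_smul_of,
          smul_mul_smul_comm, ← map_mul, mul_inv_rev, star_mul]

instance : StarModule ℂ (GroupAlg G) where
  star_smul c f := by
    induction f using induction_smul_of with
    | zero => simp only [star_zero, smul_zero]
    | smul_of d g => rw [smul_smul, star_smul_of, star_smul_of, smul_smul, star_mul']
    | add a b ha hb => simp only [star_add, smul_add, ha, hb]

section Rep

variable {H : Type u} [NormedAddCommGroup H] [InnerProductSpace ℂ H] [CompleteSpace H]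

/-- The linear extension to `ℂ[G]` of a unitary representation `π` of `G` on a Hilbert space. -/
def rep (π : G →* unitary (H →L[ℂ] H)) : GroupAlg G →ₐ[ℂ] (H →L[ℂ] H) :=
  MonoidAlgebra.lift ℂ (H →L[ℂ] H) G ((unitary (H →L[ℂ] H)).subtype.comp π)

theorem rep_of (π : G →* unitary (H →L[ℂ] H)) (g : G) : rep π (of g) = (π g : H →L[ℂ] H) :=
  MonoidAlgebra.lift_of _ _

theorem rep_star (π : G →* unitary (H →L[ℂ] H)) (f : GroupAlg G) :
    rep π (star f) = star (rep π f) := by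
  induction f using induction_smul_of with
  | zero => simp only [star_zero, map_zero]
  | smul_of c g =>
    rw [star_smul_of, map_smul, map_smul, rep_of, rep_of, star_smul, map_inv,
      ← Unitary.star_eq_inv, Unitary.coe_star]
  | add a b ha hb => simp only [star_add, map_add, ha, hb]

end Rep

/-- The set of all numbers `‖π(f)‖`, where `π` runs over the unitary representations of `G` on
Hilbert spaces. -/
def repNorms (f : GroupAlg G) : Set ℝ :=
  {r | ∃ (H : Type u) (_ : NormedAddCommGroup H) (_ : InnerProductSpace ℂ H)
    (_ : CompleteSpace H) (π : G →* unitary (H →L[ℂ] H)), r = ‖rep π f‖}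

theorem repNorms_bddAbove (f : GroupAlg G) : BddAbove (repNorms f) := by
  induction f using induction_smul_of with
  | zero =>
    refine ⟨0, ?_⟩
    rintro _ ⟨H, _, _, _, π, rfl⟩
    simp
  | smul_of c g =>
    refine ⟨‖c‖, ?_⟩
    rintro _ ⟨H, _, _, _, π, rfl⟩
    rw [map_smul, rep_of, norm_smul]
    have : ‖(π g : H →L[ℂ] H)‖ ≤ 1 := by
      rcases subsingleton_or_nontrivial (H →L[ℂ] H) with h | h
      · rw [Subsingleton.elim (π g : H →L[ℂ] H) 0]; simp
      · exact (CStarRing.norm_coe_unitary (π g)).le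
    exact mul_le_of_le_one_right (norm_nonneg _) this
  | add a b ha hb =>
    obtain ⟨A, hA⟩ := ha
    obtain ⟨B, hB⟩ := hb
    refine ⟨A + B, ?_⟩
    rintro _ ⟨H, _, _, _, π, rfl⟩
    rw [map_add]
    exact (norm_add_le _ _).trans (add_le_add (hA ⟨H, _, _, _, π, rfl⟩) (hB ⟨H, _, _, _, π, rfl⟩))

/-- The maximal C⋆-seminorm `‖f‖ = sup_π ‖π(f)‖` on the group algebra. -/
instance : Norm (GroupAlg G) where
  norm f := sSup (repNorms f)

theorem norm_rep_le {H : Type u} [NormedAddCommGroup H] [InnerProductSpace ℂ H] [CompleteSpace H]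
    (π : G →* unitary (H →L[ℂ] H)) (f : GroupAlg G) : ‖rep π f‖ ≤ ‖f‖ :=
  le_csSup (repNorms_bddAbove f) ⟨H, _, _, _, π, rfl⟩

theorem norm_nonneg_aux (f : GroupAlg G) : 0 ≤ ‖f‖ := by
  refine Real.sSup_nonneg ?_
  rintro _ ⟨H, _, _, _, π, rfl⟩
  exact norm_nonneg _

theorem norm_le_aux {f : GroupAlg G} {C : ℝ} (hC : 0 ≤ C)
    (h : ∀ (H : Type u) [NormedAddCommGroup H] [InnerProductSpace ℂ H] [CompleteSpace H]
      (π : G →* unitary (H →L[ℂ] H)), ‖rep π f‖ ≤ C) : ‖f‖ ≤ C := by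
  refine Real.sSup_le ?_ hC
  rintro _ ⟨H, _, _, _, π, rfl⟩
  exact h H π

theorem norm_mul_le_aux (f₁ f₂ : GroupAlg G) : ‖f₁ * f₂‖ ≤ ‖f₁‖ * ‖f₂‖ := by
  refine norm_le_aux (mul_nonneg (norm_nonneg_aux _) (norm_nonneg_aux _)) fun H _ _ _ π => ?_
  rw [map_mul]
  exact (norm_mul_le _ _).trans (mul_le_mul (norm_rep_le π _) (norm_rep_le π _)
    (norm_nonneg _) (norm_nonneg_aux _))

theorem norm_star_aux (f : GroupAlg G) : ‖star f‖ ≤ ‖f‖ := by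
  refine norm_le_aux (norm_nonneg_aux _) fun H _ _ _ π => ?_
  rw [rep_star, norm_star]
  exact norm_rep_le π f

/-- The seminorm axioms of `sup_π ‖π(f)‖`. -/
def core : AddGroupSeminorm (GroupAlg G) where
  toFun f := ‖f‖
  map_zero' := le_antisymm (norm_le_aux le_rfl fun H _ _ _ π => by simp) (norm_nonneg_aux _)
  add_le' f₁ f₂ := by
    refine norm_le_aux (add_nonneg (norm_nonneg_aux _) (norm_nonneg_aux _)) fun H _ _ _ π => ?_
    rw [map_add]
    exact (norm_add_le _ _).trans (add_le_add (norm_rep_le π _) (norm_rep_le π _))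
  neg' f := by
    have h : repNorms (-f) = repNorms f := by
      ext r
      simp only [repNorms, map_neg, norm_neg]
    exact congrArg sSup h

instance : SeminormedRing (GroupAlg G) where
  __ := (inferInstance : Ring (GroupAlg G))
  toNorm := inferInstance
  __ := core.toSeminormedAddCommGroup
  norm_mul_le := norm_mul_le_aux

instance : NormedAlgebra ℂ (GroupAlg G) where
  norm_smul_le c f := by
    refine norm_le_aux (mul_nonneg (norm_nonneg _) (norm_nonneg_aux _)) fun H _ _ _ π => ?_
    rw [map_smul, norm_smul]
    exact mul_le_mul_of_nonneg_left (norm_rep_le π f) (norm_nonneg _)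

instance : NormedStarGroup (GroupAlg G) where
  norm_star_le := norm_star_aux

theorem norm_mul_self_le_aux (f : GroupAlg G) : ‖f‖ * ‖f‖ ≤ ‖star f * f‖ := by
  have h : ‖f‖ ≤ Real.sqrt ‖star f * f‖ := by
    refine norm_le_aux (Real.sqrt_nonneg _) fun H _ _ _ π => ?_
    refine Real.le_sqrt_of_sq_le ?_
    rw [sq, ← CStarRing.norm_star_mul_self, ← rep_star, ← map_mul]
    exact norm_rep_le π _
  calc ‖f‖ * ‖f‖ ≤ Real.sqrt ‖star f * f‖ * Real.sqrt ‖star f * f‖ :=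
        mul_self_le_mul_self (norm_nonneg _) h
    _ = ‖star f * f‖ := Real.mul_self_sqrt (norm_nonneg _)

end GroupAlg

/-- The full group C⋆-algebra `C⋆(G)` of a discrete group `G`: the (Hausdorff) completion of
`ℂ[G]` for the norm `‖f‖ = sup_π ‖π(f)‖`, `π` running over the unitary representations of `G`. -/
def FullGroupCStar (G : Type u) [Group G] : Type u := UniformSpace.Completion (GroupAlg G)

namespace FullGroupCStar

open UniformSpace

variable {G : Type u} [Group G]

instance : NormedRing (FullGroupCStar G) :=
  inferInstanceAs (NormedRing (Completion (GroupAlg G)))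

instance : CompleteSpace (FullGroupCStar G) :=
  inferInstanceAs (CompleteSpace (Completion (GroupAlg G)))

instance : Algebra ℂ (FullGroupCStar G) :=
  inferInstanceAs (Algebra ℂ (Completion (GroupAlg G)))

/-- The canonical map `ℂ[G] → C⋆(G)`. -/
def incl : GroupAlg G →+* FullGroupCStar G := Completion.coeRingHom

theorem norm_incl (f : GroupAlg G) : ‖incl f‖ = ‖f‖ := Completion.norm_coe f

theorem incl_smul (c : ℂ) (f : GroupAlg G) : incl (c • f) = c • incl f := Completion.coe_smul c f

theorem denseRange_incl : DenseRange (incl : GroupAlg G → FullGroupCStar G) :=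
  Completion.denseRange_coe

instance : NormedAlgebra ℂ (FullGroupCStar G) where
  norm_smul_le c x := norm_smul_le (β := Completion (GroupAlg G)) c x

/-- The involution of `C⋆(G)`, the continuous extension of that of `ℂ[G]`. -/
instance : Star (FullGroupCStar G) where
  star := Completion.map (star : GroupAlg G → GroupAlg G)

theorem star_incl (f : GroupAlg G) : star (incl f) = incl (star f) :=
  Completion.map_coe star_isometry.uniformContinuous f

theorem continuous_star_aux : Continuous (star : FullGroupCStar G → FullGroupCStar G) :=
  Completion.continuous_map

instance : StarRing (FullGroupCStar G) where
  star_involutive x := by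
    refine denseRange_incl.induction_on (p := fun x => star (star x) = x) x ?_ fun f => ?_
    · exact isClosed_eq (continuous_star_aux.comp continuous_star_aux) continuous_id
    · rw [star_incl, star_incl, star_star]
  star_mul x y := by
    refine denseRange_incl.induction_on₂ (p := fun x y => star (x * y) = star y * star x)
      ?_ (fun f g => ?_) x y
    · exact isClosed_eq (continuous_star_aux.comp continuous_mul)
        ((continuous_star_aux.comp continuous_snd).mul (continuous_star_aux.comp continuous_fst))
    · rw [← map_mul, star_incl, star_incl, star_incl, star_mul, map_mul]
  star_add x y := by
    refine denseRange_incl.induction_on₂ (p := fun x y => star (x + y) = star x + star y)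
      ?_ (fun f g => ?_) x y
    · exact isClosed_eq (continuous_star_aux.comp continuous_add)
        ((continuous_star_aux.comp continuous_fst).add (continuous_star_aux.comp continuous_snd))
    · rw [← map_add, star_incl, star_incl, star_incl, star_add, map_add]

instance : StarModule ℂ (FullGroupCStar G) where
  star_smul c x := by
    refine denseRange_incl.induction_on (p := fun x => star (c • x) = star c • star x) x ?_
      fun f => ?_
    · exact isClosed_eq (continuous_star_aux.comp (continuous_const_smul c))
        (continuous_star_aux.const_smul (star c))
    · rw [← incl_smul, star_incl, star_incl, star_smul, incl_smul]

instance : CStarRing (FullGroupCStar G) where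
  norm_mul_self_le x := by
    refine denseRange_incl.induction_on (p := fun x => ‖x‖ * ‖x‖ ≤ ‖star x * x‖) x ?_
      fun f => ?_
    · exact isClosed_le (continuous_norm.mul continuous_norm)
        (continuous_norm.comp (continuous_star_aux.mul continuous_id))
    · rw [star_incl, ← map_mul, norm_incl, norm_incl]
      exact GroupAlg.norm_mul_self_le_aux f

instance : CStarAlgebra (FullGroupCStar G) where

/-- The canonical homomorphism of `G` into `C⋆(G)`, `g ↦ δ_g`. -/
def of : G →* FullGroupCStar G := (incl (G := G)).toMonoidHom.comp GroupAlg.of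

end FullGroupCStar

/-! ### Weak centrality -/

section WeaklyCentral

variable {A : Type u} [NonUnitalCStarAlgebra A]

/-- A two-sided ideal `I` is modular if `A / I` has a unit, the class of some `e`. -/
def TwoSidedIdeal.IsModular (I : TwoSidedIdeal A) : Prop :=
  ∃ e : A, ∀ a : A, a - e * a ∈ I ∧ a - a * e ∈ I

/-- The elements of `Max(A)`: modular two-sided ideals that are maximal among the proper
two-sided ideals (such ideals are automatically closed). -/
def TwoSidedIdeal.IsMaximalModular (I : TwoSidedIdeal A) : Prop :=
  I.IsModular ∧ IsCoatom I

variable (A) in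
/-- A C⋆-algebra is weakly central if `M ↦ M ∩ Z(A)` is injective on `Max(A)` and no element of
`Max(A)` contains the center `Z(A)`. -/
def IsWeaklyCentral : Prop :=
  (∀ M N : TwoSidedIdeal A, M.IsMaximalModular → N.IsMaximalModular →
    (M : Set A) ∩ Set.center A = (N : Set A) ∩ Set.center A → M = N) ∧
  ∀ M : TwoSidedIdeal A, M.IsMaximalModular → ¬ Set.center A ⊆ (M : Set A)

end WeaklyCentral

/-! ### The wallpaper group; the Euclidean plane is `ℂ` -/

namespace Wallpaper

/-- The translation `τ_{m,n}` of the plane by the vector `(m, n)`. -/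
def translation (m n : ℤ) : ℂ ≃ᵢ ℂ := IsometryEquiv.addRight (m + n * Complex.I : ℂ)

/-- The glide reflection `(x, y) ↦ (x + 1/2, -y)` of the plane. -/
def glide : ℂ ≃ᵢ ℂ :=
  Complex.conjLIE.toIsometryEquiv.trans (IsometryEquiv.addRight (1 / 2 : ℂ))

/-- The crystallographic group generated by the integer translations and the glide reflection. -/
def group : Subgroup (ℂ ≃ᵢ ℂ) :=
  Subgroup.closure (insert glide (Set.range fun v : ℤ × ℤ => translation v.1 v.2))

/-- The glide reflection as an element of the group. -/
def σ : group := ⟨glide, Subgroup.subset_closure (Set.mem_insert _ _)⟩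

/-- The translation `τ_{m,n}` as an element of the group. -/
def τ (m n : ℤ) : group :=
  ⟨translation m n, Subgroup.subset_closure (Set.mem_insert_of_mem _ ⟨(m, n), rfl⟩)⟩

theorem translation_apply (m n : ℤ) (z : ℂ) : translation m n z = z + (m + n * Complex.I) := rfl

theorem glide_apply (z : ℂ) : glide z = (starRingEnd ℂ) z + 1 / 2 := rfl

theorem τ_mul_τ (m n m' n' : ℤ) : τ m n * τ m' n' = τ (m + m') (n + n') := by
  ext z
  change translation m n (translation m' n' z) = translation (m + m') (n + n') z
  simp only [translation_apply]
  push_cast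
  ring

theorem σ_mul_τ (m n : ℤ) : σ * τ m (-n) = τ m n * σ := by
  ext z
  change glide (translation m (-n) z) = translation m n (glide z)
  simp only [translation_apply, glide_apply]
  simp
  ring

theorem σ_sq : σ ^ 2 = τ 1 0 := by
  rw [sq]
  ext z
  change glide (glide z) = translation 1 0 z
  simp only [translation_apply, glide_apply]
  simp only [map_add, map_div₀, map_one, map_ofNat, Complex.conj_conj]
  push_cast
  ring

/-- `G = {τ_{m,n}, σ τ_{m,n} : m, n ∈ ℤ}`. -/
theorem eq_τ_or_eq_σ_mul_τ (g : group) : ∃ m n : ℤ, g = τ m n ∨ g = σ * τ m n := by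
  have τ_inv (m n : ℤ) : (τ m n)⁻¹ = τ (-m) (-n) := by
    rw [inv_eq_iff_mul_eq_one, τ_mul_τ]
    ext z
    change translation (m + -m) (n + -n) z = z
    simp [translation_apply]
  have τ_mul_σ (m n : ℤ) : τ m n * σ = σ * τ m (-n) := (σ_mul_τ m n).symm
  have σσ : σ * σ = τ 1 0 := by rw [← sq, σ_sq]
  have σ_inv : σ⁻¹ = σ * τ (-1) 0 := by
    rw [inv_eq_iff_mul_eq_one, ← mul_assoc, σσ, τ_mul_τ]
    ext z
    change translation (1 + -1) (0 + 0) z = z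
    simp [translation_apply]
  obtain ⟨g, hg⟩ := g
  induction hg using Subgroup.closure_induction with
  | mem x hx =>
    rcases hx with rfl | ⟨⟨m, n⟩, rfl⟩
    · refine ⟨0, 0, Or.inr ?_⟩
      ext z
      change glide z = glide (translation 0 0 z)
      simp [translation_apply]
    · exact ⟨m, n, Or.inl rfl⟩
  | one =>
    refine ⟨0, 0, Or.inl ?_⟩
    ext z
    change z = translation 0 0 z
    simp [translation_apply]
  | mul x y hx hy ihx ihy =>
    obtain ⟨m, n, h⟩ := ihx
    obtain ⟨m', n', h'⟩ := ihy
    have key : (⟨x * y, mul_mem hx hy⟩ : group) = ⟨x, hx⟩ * ⟨y, hy⟩ := rfl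
    change ∃ m n : ℤ, (⟨x * y, mul_mem hx hy⟩ : group) = τ m n ∨ _ = σ * τ m n
    rw [key]
    rcases h with h | h <;> rcases h' with h' | h' <;> rw [h, h']
    · exact ⟨_, _, Or.inl (τ_mul_τ _ _ _ _)⟩
    · exact ⟨_, _, Or.inr (by rw [← mul_assoc, τ_mul_σ, mul_assoc, τ_mul_τ])⟩
    · exact ⟨_, _, Or.inr (by rw [mul_assoc, τ_mul_τ])⟩
    · exact ⟨_, _, Or.inl (by
        rw [mul_assoc, ← mul_assoc (τ m n), τ_mul_σ, mul_assoc, τ_mul_τ, ← mul_assoc, σσ,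
          τ_mul_τ])⟩
  | inv x hx ih =>
    obtain ⟨m, n, h⟩ := ih
    have key : (⟨x⁻¹, inv_mem hx⟩ : group) = (⟨x, hx⟩ : group)⁻¹ := rfl
    change ∃ m n : ℤ, (⟨x⁻¹, inv_mem hx⟩ : group) = τ m n ∨ _ = σ * τ m n
    rw [key]
    rcases h with h | h <;> rw [h]
    · exact ⟨_, _, Or.inl (τ_inv _ _)⟩
    · exact ⟨_, _, Or.inr (by
        rw [mul_inv_rev, τ_inv, σ_inv, ← mul_assoc, τ_mul_σ, mul_assoc, τ_mul_τ])⟩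

end Wallpaper

end

/-! The group is generated by `σ` and `d = τ_{0,1}`, subject to the single relation
`σ d = d⁻¹ σ`. So `σ ↦ diag(α, -α)` and `d ↦` rotation by `θ` define a two-dimensional unitary
representation `ρ_θ`. An element of the center acts under `ρ_θ` by a matrix that commutes with the
rotation, and such a matrix has equal diagonal entries as soon as `sin θ ≠ 0`. As `θ → 0` the
representations `ρ_θ` converge pointwise on `C⋆(G)` to the direct sum of the two characters
`σ ↦ ±α`, `d ↦ 1`, which therefore agree on the center.
-/

noncomputable section

universe u

open Filter Topology

section Characters

variable {R A F : Type*} [CommRing R] [Ring A] [Algebra R A] [FunLike F A R] [AlgHomClass F R A R]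

theorem sub_algebraMap_apply_mem_ker (φ : F) (a : A) :
    a - algebraMap R A (φ a) ∈ TwoSidedIdeal.ker φ := by
  rw [TwoSidedIdeal.mem_ker, map_sub, AlgHomClass.commutes, Algebra.algebraMap_self_apply,
    sub_self]

theorem twoSidedIdeal_ker_injective :
    Function.Injective fun φ : F => TwoSidedIdeal.ker φ := by
  refine fun φ ψ h => DFunLike.ext φ ψ fun a => ?_
  have ha : a - algebraMap R A (ψ a) ∈ TwoSidedIdeal.ker φ := by
    rw [show TwoSidedIdeal.ker φ = TwoSidedIdeal.ker ψ from h]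
    exact sub_algebraMap_apply_mem_ker ψ a
  rwa [TwoSidedIdeal.mem_ker, map_sub, AlgHomClass.commutes, sub_eq_zero] at ha

end Characters

section FieldCharacters

variable {K A F : Type*} [Field K] [Ring A] [Algebra K A] [FunLike F A K] [AlgHomClass F K A K]

theorem isCoatom_twoSidedIdeal_ker (φ : F) : IsCoatom (TwoSidedIdeal.ker φ) := by
  refine ⟨fun h => ?_, fun I hI => ?_⟩
  · rw [← TwoSidedIdeal.one_mem_iff, TwoSidedIdeal.mem_ker, map_one] at h
    exact one_ne_zero h
  · obtain ⟨hle, a, haI, ha⟩ := SetLike.lt_iff_le_and_exists.1 hI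
    rw [TwoSidedIdeal.mem_ker] at ha
    have hscalar : algebraMap K A (φ a) ∈ I := by
      simpa using I.sub_mem haI (hle (sub_algebraMap_apply_mem_ker φ a))
    rw [← TwoSidedIdeal.one_mem_iff, ← map_one (algebraMap K A), ← inv_mul_cancel₀ ha, map_mul]
    exact I.mul_mem_left _ _ hscalar

theorem isMaximal_comap_ker_val (S : Subalgebra K A) (φ : F) :
    ((RingHom.ker φ).comap S.val).IsMaximal :=
  RingHom.ker_isMaximal_of_surjective ((AlgHomClass.toAlgHom φ).comp S.val) fun c =>
    ⟨algebraMap K S c, AlgHom.commutes _ c⟩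

end FieldCharacters

section WeaklyCentral

variable {A : Type u} {F : Type*} [CStarAlgebra A] [FunLike F A ℂ] [AlgHomClass F ℂ A ℂ]

theorem isMaximalModular_ker (φ : F) : (TwoSidedIdeal.ker φ).IsMaximalModular :=
  ⟨⟨1, fun a => by simp⟩, isCoatom_twoSidedIdeal_ker φ⟩

theorem not_isWeaklyCentral_of_eqOn_center {φ ψ : F} (hne : φ ≠ ψ)
    (heq : Set.EqOn φ ψ (Set.center A)) : ¬ IsWeaklyCentral A := by
  rintro ⟨hinj, -⟩
  refine hne (twoSidedIdeal_ker_injective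
    (hinj _ _ (isMaximalModular_ker φ) (isMaximalModular_ker ψ) ?_))
  ext c
  refine and_congr_left fun hc => ?_
  rw [SetLike.mem_coe, SetLike.mem_coe, TwoSidedIdeal.mem_ker, TwoSidedIdeal.mem_ker, heq hc]

end WeaklyCentral

section DirectSum

variable {n A : Type*} [Fintype n] [DecidableEq n] [Semiring A] [StarRing A] [Algebra ℂ A]

/-- The direct sum of a finite family of characters of a complex ⋆-algebra, as a representation by
diagonal matrices. -/
def characterSum (φ : n → A →⋆ₐ[ℂ] ℂ) : A →⋆ₐ[ℂ] Matrix n n ℂ where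
  __ := (Matrix.diagonalAlgHom ℂ).comp (AlgHom.pi fun i => (φ i).toAlgHom)
  map_star' a := by
    change Matrix.diagonal (fun i => φ i (star a)) = star (Matrix.diagonal fun i => φ i a)
    rw [Matrix.star_eq_conjTranspose, Matrix.diagonal_conjTranspose]
    exact congrArg Matrix.diagonal (funext fun i => map_star (φ i) a)

theorem characterSum_apply (φ : n → A →⋆ₐ[ℂ] ℂ) (a : A) :
    characterSum φ a = Matrix.diagonal fun i => φ i a := rfl

end DirectSum

section DiagonalUnitary

variable {n : Type*} [Fintype n] [DecidableEq n]

theorem diagonal_circle_mem_unitaryGroup (z : n → Circle) :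
    Matrix.diagonal (fun i => (z i : ℂ)) ∈ Matrix.unitaryGroup n ℂ := by
  rw [Matrix.mem_unitaryGroup_iff, Matrix.star_eq_conjTranspose, Matrix.diagonal_conjTranspose,
    Matrix.diagonal_mul_diagonal, ← Matrix.diagonal_one]
  exact congrArg Matrix.diagonal (funext fun i => by simp [Complex.mul_conj])

/-- The torus of diagonal unitary matrices. -/
def diagonalUnitary : (n → Circle) →* Matrix.unitaryGroup n ℂ where
  toFun z := ⟨Matrix.diagonal fun i => (z i : ℂ), diagonal_circle_mem_unitaryGroup z⟩
  map_one' := Subtype.ext (by simp)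
  map_mul' z w := Subtype.ext (by simp)

end DiagonalUnitary

section Rotation

theorem rotation_mem_unitaryGroup (θ : ℝ) :
    !![(Real.cos θ : ℂ), -Real.sin θ; Real.sin θ, Real.cos θ] ∈ Matrix.unitaryGroup (Fin 2) ℂ := by
  have h : (Real.cos θ : ℂ) ^ 2 + Real.sin θ ^ 2 = 1 := mod_cast Real.cos_sq_add_sin_sq θ
  have hstar : star !![(Real.cos θ : ℂ), -Real.sin θ; Real.sin θ, Real.cos θ] =
      !![(Real.cos θ : ℂ), Real.sin θ; -Real.sin θ, Real.cos θ] := by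
    ext i j
    fin_cases i <;> fin_cases j <;> simp [-Complex.ofReal_cos, -Complex.ofReal_sin]
  rw [Matrix.mem_unitaryGroup_iff, hstar, Matrix.mul_fin_two, Matrix.one_fin_two]
  congrm !![?_, ?_; ?_, ?_]
  · linear_combination h
  · ring
  · ring
  · linear_combination h

/-- The matrix of the rotation of the plane by the angle `θ`. -/
def rotationMatrix (θ : ℝ) : Matrix.unitaryGroup (Fin 2) ℂ :=
  ⟨!![(Real.cos θ : ℂ), -Real.sin θ; Real.sin θ, Real.cos θ], rotation_mem_unitaryGroup θ⟩

theorem diagonalUnitary_semiconjBy_rotationMatrix (α : Circle) (θ : ℝ) :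
    SemiconjBy (diagonalUnitary ![α, -α]) (rotationMatrix θ) (rotationMatrix θ)⁻¹ := by
  rw [← Unitary.star_eq_inv]
  ext i j
  fin_cases i <;> fin_cases j <;>
    simp [diagonalUnitary, rotationMatrix, Matrix.mul_apply, mul_comm,
      -Complex.ofReal_cos, -Complex.ofReal_sin]

theorem continuous_coe_rotationMatrix :
    Continuous fun θ => (rotationMatrix θ : Matrix (Fin 2) (Fin 2) ℂ) := by
  have hcos : Continuous fun θ => (Real.cos θ : ℂ) :=
    Complex.continuous_ofReal.comp Real.continuous_cos
  have hsin : Continuous fun θ => (Real.sin θ : ℂ) :=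
    Complex.continuous_ofReal.comp Real.continuous_sin
  refine continuous_matrix fun i j => ?_
  fin_cases i <;> fin_cases j
  exacts [hcos, hsin.neg, hsin, hcos]

theorem apply_zero_zero_eq_apply_one_one_of_commute {R : Type*} [CommRing R] [IsDomain R] {a b : R}
    (hb : b ≠ 0) {M : Matrix (Fin 2) (Fin 2) R} (hM : Commute M !![a, -b; b, a]) :
    M 0 0 = M 1 1 := by
  have hentry := congrFun (congrFun hM.eq 1) 0
  simp only [Matrix.mul_apply, Fin.sum_univ_two, Matrix.of_apply, Matrix.cons_val',
    Matrix.cons_val_zero, Matrix.cons_val_one, Matrix.cons_val_fin_one] at hentry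
  refine mul_right_cancel₀ hb ?_
  linear_combination -hentry

end Rotation

section InvertingConjugation

variable {U : Type*} [Group U] {S D : U}

theorem semiconjBy_zpow_zpow_of_inv (h : SemiconjBy S D D⁻¹) (k n : ℤ) :
    SemiconjBy (S ^ k) (D ^ n) (D ^ (k.negOnePow * n : ℤ)) := by
  have hS (n : ℤ) : SemiconjBy S (D ^ n) (D ^ (-n)) := by
    simpa only [inv_zpow'] using h.zpow_right n
  have hS_inv (n : ℤ) : SemiconjBy S⁻¹ (D ^ n) (D ^ (-n)) := by
    simpa only [neg_neg] using (hS (-n)).inv_symm_left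
  induction k generalizing n with
  | zero => simp
  | succ k ih =>
    rw [zpow_add_one, Int.negOnePow_succ, Units.val_neg, neg_mul_comm]
    exact (ih (-n)).mul_left (hS n)
  | pred k ih =>
    rw [zpow_sub_one, Int.negOnePow_sub, Int.negOnePow_one, mul_neg_one, Units.val_neg,
      neg_mul_comm]
    exact (ih (-n)).mul_left (hS_inv n)

theorem zpow_mul_zpow_mul_zpow_mul_zpow (h : SemiconjBy S D D⁻¹) (n k n' k' : ℤ) :
    D ^ n * S ^ k * (D ^ n' * S ^ k') = D ^ (n + k.negOnePow * n') * S ^ (k + k') := by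
  rw [mul_assoc, ← mul_assoc (S ^ k), (semiconjBy_zpow_zpow_of_inv h k n').eq, mul_assoc,
    ← zpow_add, ← mul_assoc, ← zpow_add]

end InvertingConjugation

section Contraction

theorem lipschitzWith_one_of_starHomClass {A B F : Type*} [NonUnitalCStarAlgebra A]
    [NonUnitalCStarAlgebra B] [FunLike F A B] [NonUnitalAlgHomClass F ℂ A B] [StarHomClass F A B]
    (φ : F) : LipschitzWith 1 φ :=
  AddMonoidHomClass.lipschitz_of_bound_nnnorm φ 1 fun a => by
    simpa using NonUnitalStarAlgHom.nnnorm_apply_le φ a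

end Contraction

namespace FullGroupCStar

variable {G : Type u} [Group G]

section Lift

variable {H : Type u} [NormedAddCommGroup H] [InnerProductSpace ℂ H] [CompleteSpace H]

theorem continuous_rep (π : G →* unitary (H →L[ℂ] H)) : Continuous (GroupAlg.rep π) :=
  AddMonoidHomClass.continuous_of_bound (GroupAlg.rep π) 1 fun f => by
    simpa using GroupAlg.norm_rep_le π f

/-- The representation of `C⋆(G)` that integrates a unitary representation of `G`. -/
def lift (π : G →* unitary (H →L[ℂ] H)) : FullGroupCStar G →⋆ₐ[ℂ] (H →L[ℂ] H) :=
  let ρ : FullGroupCStar G →+* (H →L[ℂ] H) :=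
    UniformSpace.Completion.extensionHom (GroupAlg.rep π).toRingHom (continuous_rep π)
  have hρ : Continuous ρ := UniformSpace.Completion.continuous_extension
  have ρ_incl (f : GroupAlg G) : ρ (incl f) = GroupAlg.rep π f :=
    UniformSpace.Completion.extensionHom_coe _ (continuous_rep π) f
  { ρ with
    commutes' := fun c => by
      change ρ (algebraMap ℂ _ c) = _
      rw [Algebra.algebraMap_eq_smul_one, ← map_one incl, ← incl_smul, ρ_incl, map_smul, map_one,
        Algebra.algebraMap_eq_smul_one]
    map_star' := fun x => by
      refine denseRange_incl.induction_on (p := fun x => ρ (star x) = star (ρ x)) x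
        (isClosed_eq (hρ.comp continuous_star_aux) hρ.star) fun f => ?_
      rw [star_incl, ρ_incl, ρ_incl, GroupAlg.rep_star] }

theorem lift_of (π : G →* unitary (H →L[ℂ] H)) (g : G) : lift π (of g) = (π g : H →L[ℂ] H) :=
  (UniformSpace.Completion.extensionHom_coe _ (continuous_rep π) _).trans (GroupAlg.rep_of π g)

end Lift

section Convergence

theorem induction_of {p : FullGroupCStar G → Prop} (hp : IsClosed {x | p x})
    (smul_of : ∀ (c : ℂ) (g : G), p (c • of g)) (add : ∀ x y, p x → p y → p (x + y))
    (x : FullGroupCStar G) : p x := by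
  refine denseRange_incl.induction_on x hp fun f => ?_
  induction f using GroupAlg.induction_smul_of with
  | zero => simpa only [map_zero, zero_smul] using smul_of 0 1
  | smul_of c g => rw [incl_smul]; exact smul_of c g
  | add a b ha hb => rw [map_add]; exact add _ _ ha hb

theorem star_of (g : G) : star (of g) = of g⁻¹ := by
  have h := GroupAlg.star_smul_of 1 g
  rw [star_one, one_smul, one_smul] at h
  exact (star_incl _).trans (congrArg incl h)

variable {B ι : Type*} [CStarAlgebra B] {l : Filter ι} {φ : ι → FullGroupCStar G →⋆ₐ[ℂ] B}
  {ψ : FullGroupCStar G →⋆ₐ[ℂ] B}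

theorem tendsto_of_forall_tendsto_of
    (h : ∀ g, Tendsto (fun i => φ i (of g)) l (𝓝 (ψ (of g)))) (x : FullGroupCStar G) :
    Tendsto (fun i => φ i x) l (𝓝 (ψ x)) := by
  have hequi : Equicontinuous fun i => (φ i : FullGroupCStar G → B) :=
    (LipschitzWith.uniformEquicontinuous _ 1 fun i =>
      lipschitzWith_one_of_starHomClass (φ i)).equicontinuous
  refine induction_of
    (hequi.isClosed_setOfPred_tendsto (lipschitzWith_one_of_starHomClass ψ).continuous) ?_ ?_ x
  · intro c g
    simpa only [map_smul] using (h g).const_smul c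
  · intro x y hx hy
    simpa only [map_add] using hx.add hy

theorem tendsto_of_closure_eq_top {s : Set G} (hs : Subgroup.closure s = ⊤)
    (h : ∀ g ∈ s, Tendsto (fun i => φ i (of g)) l (𝓝 (ψ (of g)))) (x : FullGroupCStar G) :
    Tendsto (fun i => φ i x) l (𝓝 (ψ x)) := by
  refine tendsto_of_forall_tendsto_of (fun g => ?_) x
  have hg : g ∈ Subgroup.closure s := hs ▸ Subgroup.mem_top g
  induction hg using Subgroup.closure_induction with
  | mem g hg => exact h g hg
  | one => simpa only [map_one] using tendsto_const_nhds
  | mul g g' _ _ hg hg' => simpa only [map_mul] using hg.mul hg'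
  | inv g _ hg => simpa only [← star_of, map_star] using hg.star

end Convergence

section Matrix

variable {n : Type u} [Fintype n] [DecidableEq n]

/-- The representation of `C⋆(G)` by matrices that integrates a representation of `G` by unitary
matrices. -/
def matrixRep (v : G →* Matrix.unitaryGroup n ℂ) : FullGroupCStar G →⋆ₐ[ℂ] Matrix n n ℂ :=
  let e := Matrix.toEuclideanCLM (n := n) (𝕜 := ℂ)
  e.symm.toStarAlgHom.comp
    (lift ((Unitary.map ⟨(e : Matrix n n ℂ →* _), map_star e⟩).toMonoidHom.comp v))

theorem matrixRep_of (v : G →* Matrix.unitaryGroup n ℂ) (g : G) :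
    matrixRep v (of g) = (v g : Matrix n n ℂ) :=
  let e := Matrix.toEuclideanCLM (n := n) (𝕜 := ℂ)
  (congrArg e.symm (lift_of _ g)).trans (e.symm_apply_apply (v g))

end Matrix

section Character

/-- The one-dimensional representation of `C⋆(G)` that integrates a unitary character of `G`,
obtained as the entry of a representation by `1 × 1` matrices. -/
def character (χ : G →* Circle) : FullGroupCStar G →⋆ₐ[ℂ] ℂ where
  __ := (Matrix.uniqueAlgEquiv (m := PUnit.{u + 1}) (R := ℂ)).toAlgHom.comp
    (matrixRep (diagonalUnitary.comp (MonoidHom.pi fun _ => χ))).toAlgHom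
  map_star' x := by
    change matrixRep _ (star x) default default = star (matrixRep _ x default default)
    rw [map_star, Matrix.star_apply]

theorem character_of (χ : G →* Circle) (g : G) : character χ (of g) = (χ g : ℂ) := by
  change matrixRep _ (of g) default default = _
  rw [matrixRep_of]
  exact Matrix.diagonal_apply_eq _ _

end Character

end FullGroupCStar

namespace Wallpaper

theorem τ_zpow (m n k : ℤ) : τ m n ^ k = τ (k * m) (k * n) := by
  induction k with
  | zero =>
    ext z
    change z = translation (0 * m) (0 * n) z
    simp [translation_apply]
  | succ k ih => rw [zpow_add_one, ih, τ_mul_τ, add_one_mul, add_one_mul]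
  | pred k ih =>
    rw [zpow_sub_one, ih, mul_inv_eq_iff_eq_mul, τ_mul_τ, sub_one_mul, sub_one_mul,
      sub_add_cancel, sub_add_cancel]

theorem σ_semiconjBy : SemiconjBy σ (τ 0 1) (τ 0 1)⁻¹ := by
  rw [← zpow_neg_one, τ_zpow, mul_zero, mul_one]
  simpa only [SemiconjBy, neg_neg] using σ_mul_τ 0 (-1)

theorem σ_zpow_two_mul (m : ℤ) : σ ^ (2 * m) = τ m 0 := by
  rw [zpow_mul, zpow_ofNat, σ_sq, τ_zpow, mul_one, mul_zero]

theorem τ_eq_zpow_mul_zpow (m n : ℤ) : τ m n = τ 0 1 ^ n * σ ^ (2 * m) := by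
  rw [τ_zpow, σ_zpow_two_mul, τ_mul_τ]
  simp

theorem σ_zpow_apply_zero (k : ℤ) : (↑(σ ^ k) : ℂ ≃ᵢ ℂ) 0 = k / 2 := by
  obtain ⟨m, rfl | rfl⟩ := Int.even_or_odd' k
  · rw [σ_zpow_two_mul]
    simp [τ, translation_apply]
  · rw [zpow_add_one, σ_zpow_two_mul]
    change translation m 0 (glide 0) = _
    rw [glide_apply, translation_apply, map_zero]
    push_cast
    ring

theorem τ_zpow_mul_σ_zpow_apply_zero (n k : ℤ) :
    (↑(τ 0 1 ^ n * σ ^ k) : ℂ ≃ᵢ ℂ) 0 = k / 2 + n * Complex.I := by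
  rw [τ_zpow]
  change translation _ _ ((↑(σ ^ k) : ℂ ≃ᵢ ℂ) 0) = _
  rw [σ_zpow_apply_zero, translation_apply]
  simp

theorem τ_zpow_mul_σ_zpow_injective :
    Function.Injective fun p : ℤ × ℤ => τ 0 1 ^ p.1 * σ ^ p.2 := by
  rintro ⟨n, k⟩ ⟨n', k'⟩ h
  have h_zero : (k / 2 + n * Complex.I : ℂ) = k' / 2 + n' * Complex.I := by
    rw [← τ_zpow_mul_σ_zpow_apply_zero, ← τ_zpow_mul_σ_zpow_apply_zero]
    exact congrArg (fun g : group => (g : ℂ ≃ᵢ ℂ) 0) h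
  have hre : (k : ℝ) = k' := by simpa using congrArg Complex.re h_zero
  have him : (n : ℝ) = n' := by simpa using congrArg Complex.im h_zero
  exact Prod.ext (mod_cast him) (mod_cast hre)

theorem τ_zpow_mul_σ_zpow_surjective :
    Function.Surjective fun p : ℤ × ℤ => τ 0 1 ^ p.1 * σ ^ p.2 := by
  intro g
  obtain ⟨m, n, rfl | rfl⟩ := eq_τ_or_eq_σ_mul_τ g
  · exact ⟨(n, 2 * m), (τ_eq_zpow_mul_zpow m n).symm⟩
  · refine ⟨(-n, 2 * m + 1), ?_⟩
    have hσ : σ * τ m n = τ m (-n) * σ := by simpa only [neg_neg] using σ_mul_τ m (-n)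
    change τ 0 1 ^ (-n) * σ ^ (2 * m + 1) = _
    rw [hσ, τ_eq_zpow_mul_zpow m (-n), mul_assoc, ← zpow_add_one]

/-- Coordinates on the group: every element is uniquely of the form `τ_{0,1}ⁿ σᵏ`. -/
def normalForm : ℤ × ℤ ≃ group :=
  Equiv.ofBijective _ ⟨τ_zpow_mul_σ_zpow_injective, τ_zpow_mul_σ_zpow_surjective⟩

theorem normalForm_apply (n k : ℤ) : normalForm (n, k) = τ 0 1 ^ n * σ ^ k := rfl

theorem normalForm_mul (n k n' k' : ℤ) :
    normalForm (n, k) * normalForm (n', k') = normalForm (n + k.negOnePow * n', k + k') :=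
  zpow_mul_zpow_mul_zpow_mul_zpow σ_semiconjBy n k n' k'

theorem closure_σ_τ : Subgroup.closure {σ, τ 0 1} = ⊤ := by
  refine (Subgroup.eq_top_iff' _).2 fun g => ?_
  obtain ⟨⟨n, k⟩, rfl⟩ := normalForm.surjective g
  exact mul_mem (zpow_mem (Subgroup.subset_closure (by simp)) n)
    (zpow_mem (Subgroup.subset_closure (by simp)) k)

section Lift

variable {U : Type*} [Group U] {S D : U}

/-- The homomorphism out of the wallpaper group given by `σ ↦ S` and `τ_{0,1} ↦ D`, where
`S D = D⁻¹ S`. -/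
def lift (h : SemiconjBy S D D⁻¹) : group →* U :=
  MonoidHom.mk' (fun g => D ^ (normalForm.symm g).1 * S ^ (normalForm.symm g).2) fun a b => by
    obtain ⟨⟨n, k⟩, rfl⟩ := normalForm.surjective a
    obtain ⟨⟨n', k'⟩, rfl⟩ := normalForm.surjective b
    simp only [normalForm_mul, Equiv.symm_apply_apply, zpow_mul_zpow_mul_zpow_mul_zpow h]

theorem lift_normalForm (h : SemiconjBy S D D⁻¹) (n k : ℤ) :
    lift h (normalForm (n, k)) = D ^ n * S ^ k := by
  simp [lift]

theorem lift_σ (h : SemiconjBy S D D⁻¹) : lift h σ = S := by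
  simpa [normalForm_apply] using lift_normalForm h 0 1

theorem lift_τ (h : SemiconjBy S D D⁻¹) : lift h (τ 0 1) = D := by
  simpa [normalForm_apply] using lift_normalForm h 1 0

end Lift

section RotationRep

/-- The representation `ρ_θ` of `C⋆(G)` with `σ ↦ diag(α, -α)` and `τ_{0,1} ↦` rotation by `θ`. -/
def rotationRep (α : Circle) (θ : ℝ) :
    FullGroupCStar group →⋆ₐ[ℂ] Matrix (Fin 2) (Fin 2) ℂ :=
  FullGroupCStar.matrixRep (lift (diagonalUnitary_semiconjBy_rotationMatrix α θ))

/-- The character of `C⋆(G)` with `σ ↦ β` and `τ_{0,1} ↦ 1`. -/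
def glideChar (β : Circle) : FullGroupCStar group →⋆ₐ[ℂ] ℂ :=
  FullGroupCStar.character (lift (S := β) (D := 1) (by simp only [inv_one, SemiconjBy.one_right]))

theorem glideChar_σ (β : Circle) : glideChar β (FullGroupCStar.of σ) = β := by
  rw [glideChar, FullGroupCStar.character_of, lift_σ]

theorem glideChar_τ (β : Circle) : glideChar β (FullGroupCStar.of (τ 0 1)) = 1 := by
  rw [glideChar, FullGroupCStar.character_of, lift_τ, Circle.coe_one]

theorem glideChar_ne_glideChar_neg (α : Circle) : glideChar α ≠ glideChar (-α) := fun h =>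
  Circle.coe_ne_zero α <| self_eq_neg.1 <| by
    simpa only [glideChar_σ, Circle.coe_neg] using DFunLike.congr_fun h (FullGroupCStar.of σ)

open scoped Matrix.Norms.L2Operator in
theorem tendsto_rotationRep (α : Circle) (x : FullGroupCStar group) :
    Tendsto (fun θ => rotationRep α θ x) (𝓝 0)
      (𝓝 (characterSum ![glideChar α, glideChar (-α)] x)) := by
  refine FullGroupCStar.tendsto_of_closure_eq_top closure_σ_τ ?_ x
  rintro g (rfl | rfl)
  · have hσ (θ : ℝ) : rotationRep α θ (FullGroupCStar.of σ) =
        characterSum ![glideChar α, glideChar (-α)] (FullGroupCStar.of σ) := by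
      rw [rotationRep, FullGroupCStar.matrixRep_of, lift_σ, characterSum_apply]
      refine congrArg Matrix.diagonal (funext fun i => ?_)
      fin_cases i <;> simp [glideChar_σ]
    simpa only [hσ] using tendsto_const_nhds
  · have hτ : characterSum ![glideChar α, glideChar (-α)] (FullGroupCStar.of (τ 0 1)) =
        rotationMatrix 0 := by
      rw [characterSum_apply]
      ext i j
      fin_cases i <;> fin_cases j <;> simp [glideChar_τ, rotationMatrix]
    simpa only [rotationRep, FullGroupCStar.matrixRep_of, lift_τ, hτ] using
      continuous_coe_rotationMatrix.tendsto 0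

theorem rotationRep_apply_zero_zero_eq_apply_one_one (α : Circle) {θ : ℝ} (hθ : Real.sin θ ≠ 0)
    {c : FullGroupCStar group} (hc : c ∈ Set.center (FullGroupCStar group)) :
    rotationRep α θ c 0 0 = rotationRep α θ c 1 1 := by
  have hcomm := (hc.comm (FullGroupCStar.of (τ 0 1))).map (rotationRep α θ)
  rw [rotationRep, FullGroupCStar.matrixRep_of, lift_τ] at hcomm
  exact apply_zero_zero_eq_apply_one_one_of_commute (Complex.ofReal_ne_zero.2 hθ) hcomm

theorem glideChar_eqOn_center (α : Circle) :
    Set.EqOn (glideChar α) (glideChar (-α)) (Set.center (FullGroupCStar group)) := by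
  intro c hc
  have hlim : Tendsto (fun θ => rotationRep α θ c) (𝓝[>] 0)
      (𝓝 (characterSum ![glideChar α, glideChar (-α)] c)) :=
    (tendsto_rotationRep α c).mono_left nhdsWithin_le_nhds
  have hentry (i : Fin 2) : Tendsto (fun θ => rotationRep α θ c i i) (𝓝[>] 0)
      (𝓝 (![glideChar α, glideChar (-α)] i c)) := by
    have := (hlim.apply_nhds i).apply_nhds i
    rwa [characterSum_apply, Matrix.diagonal_apply_eq] at this
  refine tendsto_nhds_unique (hentry 0) ((hentry 1).congr' ?_)
  filter_upwards [Ioo_mem_nhdsGT Real.pi_pos] with θ hθ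
  exact (rotationRep_apply_zero_zero_eq_apply_one_one α (Real.sin_pos_of_mem_Ioo hθ).ne' hc).symm

end RotationRep

end Wallpaper

end

theorem mainTheorem8 :
    ¬ IsWeaklyCentral (FullGroupCStar Wallpaper.group) ∧
    ∀ α : Circle, ∃ π₁ π₂ : FullGroupCStar Wallpaper.group →⋆ₐ[ℂ] ℂ,
      π₁ (FullGroupCStar.of Wallpaper.σ) = (α : ℂ) ∧
      π₂ (FullGroupCStar.of Wallpaper.σ) = -(α : ℂ) ∧
      (TwoSidedIdeal.ker π₁).IsMaximalModular ∧
      (TwoSidedIdeal.ker π₂).IsMaximalModular ∧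
      TwoSidedIdeal.ker π₁ ≠ TwoSidedIdeal.ker π₂ ∧
      ∃ J : Ideal (Subalgebra.center ℂ (FullGroupCStar Wallpaper.group)), J.IsMaximal ∧
        J = (RingHom.ker π₁).comap
          (Subalgebra.center ℂ (FullGroupCStar Wallpaper.group)).val ∧
        J = (RingHom.ker π₂).comap
          (Subalgebra.center ℂ (FullGroupCStar Wallpaper.group)).val := by
  refine ⟨not_isWeaklyCentral_of_eqOn_center (Wallpaper.glideChar_ne_glideChar_neg 1)
    (Wallpaper.glideChar_eqOn_center 1), fun α => ?_⟩
  refine ⟨Wallpaper.glideChar α, Wallpaper.glideChar (-α), Wallpaper.glideChar_σ α,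
    (Wallpaper.glideChar_σ (-α)).trans (Circle.coe_neg α), isMaximalModular_ker _,
    isMaximalModular_ker _,
    twoSidedIdeal_ker_injective.ne (Wallpaper.glideChar_ne_glideChar_neg α), _,
    isMaximal_comap_ker_val _ (Wallpaper.glideChar α), rfl, ?_⟩
  ext c
  rw [Ideal.mem_comap, Ideal.mem_comap, RingHom.mem_ker, RingHom.mem_ker]
  exact Eq.congr_left (Wallpaper.glideChar_eqOn_center α c.2)
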